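/- Let $G=(V,E)$ be a finite or infinite, locally finite, simple, connected, unweighted graph which is regular (all vertices have the same finite degree) and non-bipartite. For $x\in V$ and an integer $t\ge 0$ let $p_t(x,x)$ be the probability that simple random walk on $G$ started at $x$ is at $x$ at time $t$, where at each step the walk moves to a uniformly chosen neighbour of its current position. Let $\pi(x)=\dfrac{d(x)}{\sum_{y\in V}d(y)}$, where $d(y)$ is the degree of $y$, so that $\pi(x)=1/|V|$ if $G$ is finite and $\pi(x)=0$ if $G$ is infinite. Then for each $x\in V$: $$0\le p_t(x,x)-\pi(x)\quad\text{for every even } t\ge 0,$$ $$p_t(x,x)-\pi(x)\le \frac{18}{\sqrt t}\quad\text{for every even } t\ge 2,$$ $$\bigl|p_t(x,x)-\pi(x)\bigr|\le \frac{9}{\sqrt t}\quad\text{for every odd } t\ge 1.$$ -/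

import Mathlib

open scoped ENNReal

namespace SimpleRandomWalk

/-- One step of simple random walk on a locally finite graph: from `x`, move to a uniformly chosen
neighbour of `x`. (At an isolated vertex, where there is no neighbour, the walk stays put.) -/
noncomputable def step {V : Type*} (G : SimpleGraph V) [G.LocallyFinite] (x : V) : PMF V :=
  if h : (G.neighborFinset x).Nonempty then PMF.uniformOfFinset (G.neighborFinset x) h
  else PMF.pure x

/-- The law of the position at time `t` of simple random walk on `G` started at `x`. -/
noncomputable def law {V : Type*} (G : SimpleGraph V) [G.LocallyFinite] (x : V) : ℕ → PMF V
  | 0 => PMF.pure x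
  | t + 1 => (law G x t).bind (step G)

/-- The `t`-step transition probability `p_t(x, y)` of simple random walk on `G`. -/
noncomputable def transProb {V : Type*} (G : SimpleGraph V) [G.LocallyFinite]
    (t : ℕ) (x y : V) : ℝ :=
  (law G x t y).toReal

/-- The volume `∑ x, d(x) ∈ [0, ∞]` of `G`; for a finite graph this is twice the number of edges. -/
noncomputable def vol {V : Type*} (G : SimpleGraph V) [G.LocallyFinite] : ℝ≥0∞ :=
  ∑' x : V, (G.degree x : ℝ≥0∞)

/-- The quotient `π(x) = d(x) / vol(V)`, which is `0` when the volume is infinite. -/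
noncomputable def statProb {V : Type*} (G : SimpleGraph V) [G.LocallyFinite] (x : V) : ℝ :=
  ((G.degree x : ℝ≥0∞) / vol G).toReal

end SimpleRandomWalk

/-! Put b_m = p_{2m}(x,x) − π(x). By symmetry of the walk this is the squared ℓ² norm of p_m(x,·) −
π, hence nonnegative; odd times follow from 2|⟨f,g⟩| ≤ ‖f‖² + ‖g‖².

The decrement b_m − b_{m+1} is 1/d times the Dirichlet energy of p_m and p_{m+1}, placed on the two
sheets of the bipartite double cover (`hasSum_energy`). The cover is connected because G is not
bipartite. This function has mass 2, is at least π + b_m on some lift of x, and is somewhere below π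
+ b_m/3. On a shortest path to such a low vertex it drops by 2b_m/3, while every vertex closer than
the end is high; by regularity the mass bound then limits d times the path length
(`Connected.energy_lower_bound`). Cauchy–Schwarz along the path gives b_m³ ≤ 54(b_m − b_{m+1}),
whence m·b_m² ≤ 27. -/

namespace SimpleRandomWalk

theorem hasSum_toReal_of_tsum_eq {ι : Type*} {f : ι → ℝ≥0∞} {a : ℝ≥0∞} (h : ∑' i, f i = a)
    (ha : a ≠ ∞) : HasSum (fun i => (f i).toReal) a.toReal := by
  subst h
  rw [ENNReal.tsum_toReal_eq (ENNReal.ne_top_of_tsum_ne_top ha)]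
  exact ENNReal.hasSum_toReal ha

/-! ### Symmetry of the step kernel, and even return probabilities as ℓ² norms. -/

section Regular

variable {V : Type*} {G : SimpleGraph V} [G.LocallyFinite] {d : ℕ}

theorem step_apply (hreg : G.IsRegularOfDegree d) (hd : 0 < d) (z y : V) [Decidable (G.Adj z y)] :
    step G z y = if G.Adj z y then (d : ℝ≥0∞)⁻¹ else 0 := by
  have hcard : (G.neighborFinset z).card = d := hreg z
  have hne : (G.neighborFinset z).Nonempty := Finset.card_pos.mp (by omega)
  rw [step, dif_pos hne, PMF.uniformOfFinset_apply, hcard]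
  simp only [SimpleGraph.mem_neighborFinset]

theorem step_comm (hreg : G.IsRegularOfDegree d) (hd : 0 < d) (z y : V) :
    step G z y = step G y z := by
  classical
  rw [step_apply hreg hd, step_apply hreg hd]
  simp only [G.adj_comm]

theorem tsum_mul_step (hreg : G.IsRegularOfDegree d) (hd : 0 < d) (F : V → ℝ≥0∞) (y : V) :
    ∑' z, F z * step G z y = (∑ z ∈ G.neighborFinset y, F z) * (d : ℝ≥0∞)⁻¹ := by
  classical
  rw [tsum_eq_sum (s := G.neighborFinset y), Finset.sum_mul]
  · refine Finset.sum_congr rfl fun z hz => ?_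
    rw [step_apply hreg hd, if_pos ((G.mem_neighborFinset y z).mp hz).symm]
  · intro z hz
    rw [step_apply hreg hd, if_neg, mul_zero]
    exact fun h => hz ((G.mem_neighborFinset y z).mpr h.symm)

theorem tsum_average (hreg : G.IsRegularOfDegree d) (hd : 0 < d) (F : V → ℝ≥0∞) :
    ∑' y, (∑ z ∈ G.neighborFinset y, F z) * (d : ℝ≥0∞)⁻¹ = ∑' z, F z := by
  simp_rw [← tsum_mul_step hreg hd F]
  rw [ENNReal.tsum_comm]
  simp_rw [ENNReal.tsum_mul_left, PMF.tsum_coe, mul_one]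

/-- Self-adjointness of the step kernel: one step passes from one factor to the other. -/
theorem tsum_law_succ_mul (hreg : G.IsRegularOfDegree d) (hd : 0 < d) (x : V) (m n : ℕ) :
    ∑' y, law G x (m + 1) y * law G x n y = ∑' y, law G x m y * law G x (n + 1) y := by
  simp only [law, PMF.bind_apply, ← ENNReal.tsum_mul_left, ← ENNReal.tsum_mul_right]
  rw [ENNReal.tsum_comm]
  refine tsum_congr fun y => tsum_congr fun z => ?_
  rw [step_comm hreg hd y z]
  ring

theorem tsum_law_mul_law (hreg : G.IsRegularOfDegree d) (hd : 0 < d) (x : V) (m n : ℕ) :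
    ∑' y, law G x m y * law G x n y = law G x (m + n) x := by
  classical
  induction m generalizing n with
  | zero =>
    rw [tsum_eq_single x]
    · simp [law]
    · intro y hy
      simp [law, hy]
  | succ m ih =>
    rw [tsum_law_succ_mul hreg hd, ih]
    congr 2
    omega

theorem transProb_nonneg (t : ℕ) (x y : V) : 0 ≤ transProb G t x y := ENNReal.toReal_nonneg

theorem transProb_le_one (t : ℕ) (x y : V) : transProb G t x y ≤ 1 :=
  ENNReal.toReal_le_of_le_ofReal zero_le_one (by simpa using PMF.coe_le_one _ _)

theorem hasSum_transProb (t : ℕ) (x : V) : HasSum (transProb G t x) 1 := by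
  simpa using! hasSum_toReal_of_tsum_eq (law G x t).tsum_coe ENNReal.one_ne_top

theorem transProb_succ (hreg : G.IsRegularOfDegree d) (hd : 0 < d) (t : ℕ) (x y : V) :
    transProb G (t + 1) x y = (∑ z ∈ G.neighborFinset y, transProb G t x z) / d := by
  rw [transProb, law, PMF.bind_apply, tsum_mul_step hreg hd, ENNReal.toReal_mul,
    ENNReal.toReal_sum fun z _ => PMF.apply_ne_top _ _, div_eq_mul_inv]
  simp [transProb]

theorem hasSum_transProb_mul (hreg : G.IsRegularOfDegree d) (hd : 0 < d) (x : V) (m n : ℕ) :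
    HasSum (fun y => transProb G m x y * transProb G n x y) (transProb G (m + n) x x) := by
  have h := hasSum_toReal_of_tsum_eq (tsum_law_mul_law hreg hd x m n) (PMF.apply_ne_top _ _)
  simpa only [ENNReal.toReal_mul] using! h

theorem hasSum_average_sq (hreg : G.IsRegularOfDegree d) (hd : 0 < d) (x : V) (m : ℕ) :
    HasSum (fun y => (∑ z ∈ G.neighborFinset y, transProb G m x z ^ 2) / d)
      (transProb G (2 * m) x x) := by
  have key : ∑' y, (∑ z ∈ G.neighborFinset y, law G x m z ^ 2) * (d : ℝ≥0∞)⁻¹ =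
      law G x (2 * m) x := by
    rw [tsum_average hreg hd, two_mul, ← tsum_law_mul_law hreg hd]
    simp_rw [sq]
  refine (hasSum_toReal_of_tsum_eq key (PMF.apply_ne_top _ _)).congr_fun fun y => ?_
  rw [ENNReal.toReal_mul, ENNReal.toReal_sum fun z _ => ENNReal.pow_ne_top (PMF.apply_ne_top _ _),
    div_eq_mul_inv]
  simp [transProb]

/-- The decrease of the even return probabilities is the Dirichlet energy of the transition
probabilities on the bipartite double cover. -/
theorem hasSum_energy (hreg : G.IsRegularOfDegree d) (hd : 0 < d) (x : V) (m : ℕ) :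
    HasSum (fun y => (∑ z ∈ G.neighborFinset y,
        (transProb G m x z - transProb G (m + 1) x y) ^ 2) / d)
      (transProb G (2 * m) x x - transProb G (2 * (m + 1)) x x) := by
  have h := (hasSum_average_sq hreg hd x m).sub (hasSum_transProb_mul hreg hd x (m + 1) (m + 1))
  rw [← two_mul] at h
  refine h.congr_fun fun y => ?_
  have hd' : (d : ℝ) ≠ 0 := by positivity
  have hs : ∑ z ∈ G.neighborFinset y, transProb G m x z = d * transProb G (m + 1) x y := by
    rw [transProb_succ hreg hd]
    field_simp
  have hcard : (G.neighborFinset y).card = d := hreg y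
  -- Mean of squares minus square of the mean: `p_{m+1}(x,y)` is the mean of `p_m(x,·)` over the
  -- neighbours of `y`.
  simp_rw [sub_sq]
  rw [Finset.sum_add_distrib, Finset.sum_sub_distrib, ← Finset.sum_mul, ← Finset.mul_sum, hs,
    Finset.sum_const, hcard, nsmul_eq_mul]
  field_simp
  ring

end Regular

/-! ### Centring at π: lower bound at even times, comparison of odd with even times. -/

section Stationary

variable {V : Type*} {G : SimpleGraph V} [G.LocallyFinite] {d : ℕ}

theorem statProb_of_infinite [Infinite V] (hreg : G.IsRegularOfDegree d) (hd : 0 < d) (x : V) :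
    statProb G x = 0 := by
  have hv : vol G = ∞ := by
    simp only [vol, hreg.degree_eq]
    exact ENNReal.tsum_const_eq_top_of_ne_zero (by simpa using hd.ne')
  simp [statProb, hv]

theorem card_mul_statProb [Fintype V] (hreg : G.IsRegularOfDegree d) (hd : 0 < d) (x : V) :
    (Fintype.card V : ℝ) * statProb G x = 1 := by
  have : Nonempty V := ⟨x⟩
  have hd' : (d : ℝ) ≠ 0 := by positivity
  have hc : (Fintype.card V : ℝ) ≠ 0 := by simp
  simp only [statProb, vol, hreg.degree_eq, tsum_fintype, Finset.sum_const, Finset.card_univ,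
    ENNReal.toReal_div, nsmul_eq_mul, ENNReal.toReal_mul, ENNReal.toReal_natCast]
  field_simp

theorem statProb_nonneg (x : V) : 0 ≤ statProb G x := ENNReal.toReal_nonneg

theorem statProb_le_one (hreg : G.IsRegularOfDegree d) (hd : 0 < d) (x : V) :
    statProb G x ≤ 1 := by
  cases fintypeOrInfinite V
  · have : Nonempty V := ⟨x⟩
    have h := card_mul_statProb hreg hd x
    have h1 : (1 : ℝ) ≤ Fintype.card V := by exact_mod_cast Fintype.card_pos
    nlinarith [statProb_nonneg (G := G) x]
  · simp [statProb_of_infinite hreg hd x]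

theorem hasSum_statProb_sq (hreg : G.IsRegularOfDegree d) (hd : 0 < d) (x : V) :
    HasSum (fun _ : V => statProb G x ^ 2) (statProb G x) := by
  cases fintypeOrInfinite V
  · convert hasSum_fintype (fun _ : V => statProb G x ^ 2) using 1
    rw [Finset.sum_const, Finset.card_univ, nsmul_eq_mul, sq, ← mul_assoc,
      card_mul_statProb hreg hd, one_mul]
  · simp [statProb_of_infinite hreg hd x]

/-- Otherwise the total mass would exceed 1. This supplies the low vertex of the energy bound. -/
theorem exists_transProb_lt (hreg : G.IsRegularOfDegree d) (hd : 0 < d) (x : V) (t : ℕ) {θ : ℝ}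
    (hθ : 0 < θ) : ∃ y, transProb G t x y < statProb G x + θ := by
  by_contra! h
  have hsum := hasSum_transProb (G := G) t x
  cases fintypeOrInfinite V
  · have : Nonempty V := ⟨x⟩
    have h1 : ∑ y, transProb G t x y = 1 := (hasSum_fintype _).unique hsum
    have h2 := Finset.sum_le_sum fun y (_ : y ∈ Finset.univ) => h y
    rw [h1, Finset.sum_const, Finset.card_univ, nsmul_eq_mul, mul_add,
      card_mul_statProb hreg hd] at h2
    have h3 : 0 < (Fintype.card V : ℝ) * θ := mul_pos (by exact_mod_cast Fintype.card_pos) hθ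
    linarith
  · have h2 : Summable fun _ : V => θ :=
      Summable.of_nonneg_of_le (fun _ => hθ.le)
        (fun y => by have := h y; rw [statProb_of_infinite hreg hd, zero_add] at this; exact this)
        hsum.summable
    exact hθ.ne' (summable_const_iff θ |>.mp h2)

theorem hasSum_sub_statProb_mul (hreg : G.IsRegularOfDegree d) (hd : 0 < d) (x : V) (m n : ℕ) :
    HasSum (fun y => (transProb G m x y - statProb G x) * (transProb G n x y - statProb G x))
      (transProb G (m + n) x x - statProb G x) := by
  have h := (((hasSum_transProb_mul hreg hd x m n).sub
    ((hasSum_transProb (G := G) m x).mul_left (statProb G x))).sub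
    ((hasSum_transProb (G := G) n x).mul_left (statProb G x))).add (hasSum_statProb_sq hreg hd x)
  rw [show transProb G (m + n) x x - statProb G x * 1 - statProb G x * 1 + statProb G x =
    transProb G (m + n) x x - statProb G x by ring] at h
  exact h.congr_fun fun y => by ring

theorem statProb_le_transProb_even (hreg : G.IsRegularOfDegree d) (hd : 0 < d) (x : V) (m : ℕ) :
    0 ≤ transProb G (2 * m) x x - statProb G x := by
  rw [two_mul]
  exact (hasSum_sub_statProb_mul hreg hd x m m).nonneg fun y => mul_self_nonneg _

theorem abs_transProb_odd_le (hreg : G.IsRegularOfDegree d) (hd : 0 < d) (x : V) (m : ℕ) :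
    2 * |transProb G (2 * m + 1) x x - statProb G x| ≤
      (transProb G (2 * m) x x - statProb G x) +
        (transProb G (2 * (m + 1)) x x - statProb G x) := by
  have h0 := hasSum_sub_statProb_mul hreg hd x m m
  have h1 := (hasSum_sub_statProb_mul hreg hd x m (m + 1)).mul_left 2
  have h2 := hasSum_sub_statProb_mul hreg hd x (m + 1) (m + 1)
  have hp := ((h0.add h2).add h1).nonneg fun y => by
    nlinarith [sq_nonneg (transProb G m x y - statProb G x +
      (transProb G (m + 1) x y - statProb G x))]
  have hm := ((h0.add h2).sub h1).nonneg fun y => by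
    nlinarith [sq_nonneg (transProb G m x y - statProb G x -
      (transProb G (m + 1) x y - statProb G x))]
  rw [← two_mul, ← two_mul, ← add_assoc, ← two_mul] at hp hm
  rcases abs_cases (transProb G (2 * m + 1) x x - statProb G x) with h | h <;> linarith

end Stationary

end SimpleRandomWalk

/-! ### Geodesics and the energy bound in a regular graph. -/

namespace SimpleGraph

variable {W : Type*} {Γ : SimpleGraph W}

theorem Connected.exists_geodesic (hΓ : Γ.Connected) (u v : W) :
    ∃ w : ℕ → W, w 0 = u ∧ w (Γ.dist u v) = v ∧
      (∀ i < Γ.dist u v, Γ.Adj (w i) (w (i + 1))) ∧ ∀ i ≤ Γ.dist u v, Γ.dist u (w i) = i := by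
  obtain ⟨p, hp⟩ := hΓ.exists_walk_length_eq_dist u v
  refine ⟨p.getVert, p.getVert_zero, by rw [← hp, p.getVert_length],
    fun i hi => p.adj_getVert_succ (hp ▸ hi), fun i hi => ?_⟩
  have h1 : Γ.dist u (p.getVert i) ≤ i :=
    (dist_le (p.take i)).trans (by rw [Walk.take_length]; omega)
  have h2 : Γ.dist (p.getVert i) v ≤ Γ.dist u v - i :=
    (dist_le (p.drop i)).trans (by rw [Walk.drop_length]; omega)
  have h3 := hΓ.dist_triangle (u := u) (v := p.getVert i) (w := v)
  omega

/-- In a connected regular graph, a function of mass at most `M` which drops by at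
least `δ` from `v₀` to the nonempty set where it is less than `τ` has large Dirichlet energy. -/
theorem Connected.energy_lower_bound [Γ.LocallyFinite] {d : ℕ} (hΓ : Γ.Connected)
    (hreg : Γ.IsRegularOfDegree d) (hd : 0 < d) {H : W → ℝ} {M E τ δ : ℝ}
    (hM : ∀ F : Finset W, ∑ w ∈ F, H w ≤ M)
    (hE : ∀ F : Finset (W × W), (∀ p ∈ F, Γ.Adj p.1 p.2) → (∀ p ∈ F, p.swap ∉ F) →
      ∑ p ∈ F, (H p.1 - H p.2) ^ 2 ≤ E)
    (hτ : 0 < τ) (hδ : 0 ≤ δ) {v₀ : W} (hv₀ : τ + δ ≤ H v₀) (hlow : ∃ w, H w < τ) :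
    d * δ ^ 2 * τ ≤ 4 * M * E := by
  classical
  have hhigh : ∀ F : Finset W, (∀ w ∈ F, τ ≤ H w) → τ * F.card ≤ M := fun F hF => by
    refine le_trans ?_ (hM F)
    rw [mul_comm, ← nsmul_eq_mul]
    exact Finset.card_nsmul_le_sum F H τ hF
  obtain ⟨u, hu, hmin⟩ : ∃ u, H u < τ ∧ ∀ w, H w < τ → Γ.dist v₀ u ≤ Γ.dist v₀ w := by
    obtain ⟨u, hu, h⟩ := exists_minimalFor_of_wellFoundedLT (fun w => H w < τ) (Γ.dist v₀) hlow
    exact ⟨u, hu, fun w hw => (le_total _ _).elim id fun h' => h hw h'⟩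
  have hnear : ∀ w, Γ.dist v₀ w < Γ.dist v₀ u → τ ≤ H w := fun w hw => by
    by_contra! h
    exact absurd (hmin w h) (by omega)
  have hE0 : 0 ≤ E := by simpa using hE ∅ (by simp) (by simp)
  obtain ⟨w, hw0, hwL, hadj, hdist⟩ := hΓ.exists_geodesic v₀ u
  set L := Γ.dist v₀ u with hL
  have hne : v₀ ≠ u := by rintro rfl; linarith
  have hLpos : 0 < L := hΓ.pos_dist_of_ne hne
  have hcard : ∀ v, (Γ.neighborFinset v).card = d := fun v => hreg v
  have hdR : (0 : ℝ) < d := by exact_mod_cast hd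
  have hM1 : τ ≤ M := by
    have := hhigh {v₀} (by simpa using by linarith)
    simpa using this
  rcases Nat.lt_or_ge 1 L with hL2 | hL1
  · have hdM : τ * d ≤ M := by
      rw [← hcard v₀]
      refine hhigh _ fun z hz => hnear z ?_
      rw [dist_eq_one_iff_adj.mpr ((Γ.mem_neighborFinset _ _).mp hz)]
      exact hL2
    -- Stopping at `w (L - 2)` keeps all these neighbourhoods within distance `L - 1` of `v₀`, where
    -- `H ≥ τ`.
    have hvol : τ * ((L - 1 : ℕ) * d) ≤ 3 * M := by
      set T := (Finset.range (L - 1)).biUnion fun i => Γ.neighborFinset (w i) with hT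
      have hTM : τ * T.card ≤ M := by
        refine hhigh T fun z hz => hnear z ?_
        simp only [hT, Finset.mem_biUnion, Finset.mem_range, mem_neighborFinset] at hz
        obtain ⟨i, hi, hz⟩ := hz
        have h1 := hΓ.dist_triangle (u := v₀) (v := w i) (w := z)
        rw [dist_eq_one_iff_adj.mpr hz, hdist i (by omega)] at h1
        omega
      have hcount : (L - 1) * d ≤ T.card * 3 := by
        have h := Finset.sum_card_bipartiteAbove_eq_sum_card_bipartiteBelow
          (s := Finset.range (L - 1)) (t := T) (fun i z => Γ.Adj (w i) z)
        have h1 : ∀ i ∈ Finset.range (L - 1),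
            (Finset.bipartiteAbove (fun i z => Γ.Adj (w i) z) T i).card = d := fun i hi => by
          rw [← hcard (w i)]
          congr 1
          ext z
          simp only [Finset.mem_bipartiteAbove, mem_neighborFinset, and_iff_right_iff_imp]
          exact fun hz => Finset.mem_biUnion.mpr ⟨i, hi, (Γ.mem_neighborFinset _ _).mpr hz⟩
        -- Distances to `v₀` of adjacent vertices differ by at most 1, and `w i` is at distance `i`.
        have h2 : ∀ z ∈ T,
            (Finset.bipartiteBelow (fun i z => Γ.Adj (w i) z) (Finset.range (L - 1)) z).card ≤
              3 := fun z _ => by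
          refine (Finset.card_le_card (t := Finset.Icc (Γ.dist v₀ z - 1) (Γ.dist v₀ z + 1))
            fun i hi => ?_).trans (by rw [Nat.card_Icc]; omega)
          obtain ⟨hi, hz⟩ := (Finset.mem_bipartiteBelow _).mp hi
          have hi' := Finset.mem_range.mp hi
          have h1 := hΓ.dist_triangle (u := v₀) (v := w i) (w := z)
          have h2 := hΓ.dist_triangle (u := v₀) (v := z) (w := w i)
          rw [dist_eq_one_iff_adj.mpr hz, hdist i (by omega)] at h1
          rw [dist_eq_one_iff_adj.mpr hz.symm, hdist i (by omega)] at h2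
          rw [Finset.mem_Icc]
          omega
        rw [Finset.sum_congr rfl h1, Finset.sum_const, Finset.card_range, smul_eq_mul] at h
        rw [h]
        exact Finset.sum_le_card_nsmul _ _ _ h2
      have : ((L - 1 : ℕ) : ℝ) * d ≤ T.card * 3 := by exact_mod_cast hcount
      nlinarith
    have hpath : δ ^ 2 ≤ L * E := by
      have hsum : ∑ i ∈ Finset.range L, (H (w i) - H (w (i + 1))) = H v₀ - H u := by
        rw [Finset.sum_range_sub', hw0, hwL]
      have hcs := sq_sum_le_card_mul_sum_sq (s := Finset.range L)
        (f := fun i => H (w i) - H (w (i + 1)))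
      rw [hsum, Finset.card_range] at hcs
      have hinj : Set.InjOn (fun i => (w i, w (i + 1))) (Finset.range L) := by
        intro i hi j hj h
        have h1 : w i = w j := congrArg Prod.fst h
        have hi' := Finset.mem_range.mp hi
        have hj' := Finset.mem_range.mp hj
        rw [← hdist i (by omega), h1, hdist j (by omega)]
      have hen := hE ((Finset.range L).image fun i => (w i, w (i + 1)))
        (fun p hp => by
          obtain ⟨i, hi, rfl⟩ := Finset.mem_image.mp hp
          exact hadj i (Finset.mem_range.mp hi))
        (fun p hp hq => by
          obtain ⟨i, hi, rfl⟩ := Finset.mem_image.mp hp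
          obtain ⟨j, hj, h⟩ := Finset.mem_image.mp hq
          have hi' := Finset.mem_range.mp hi
          have hj' := Finset.mem_range.mp hj
          have h1 : w j = w (i + 1) := congrArg Prod.fst h
          have h2 : w (j + 1) = w i := congrArg Prod.snd h
          have h3 := congrArg (Γ.dist v₀) h1
          have h4 := congrArg (Γ.dist v₀) h2
          rw [hdist j (by omega), hdist (i + 1) (by omega)] at h3
          rw [hdist (j + 1) (by omega), hdist i (by omega)] at h4
          omega)
      rw [Finset.sum_image hinj] at hen
      have h1 : δ ^ 2 ≤ (H v₀ - H u) ^ 2 := pow_le_pow_left₀ hδ (by linarith) 2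
      have h2 := mul_le_mul_of_nonneg_left hen (Nat.cast_nonneg (α := ℝ) L)
      exact h1.trans (hcs.trans h2)
    -- The 4 is 3 from the overlaps plus 1 from `hdM`, for the omitted index.
    have hLM : τ * (L * d) ≤ 4 * M := by
      have : (L : ℝ) = (L - 1 : ℕ) + 1 := by
        exact_mod_cast (Nat.sub_add_cancel hLpos).symm
      rw [this]
      linarith
    calc d * δ ^ 2 * τ = (τ * d) * δ ^ 2 := by ring
      _ ≤ (τ * d) * (L * E) := by gcongr
      _ = (τ * (L * d)) * E := by ring
      _ ≤ 4 * M * E := by gcongr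
  · have hL1' : L = 1 := by omega
    have hau : Γ.Adj v₀ u := dist_eq_one_iff_adj.mp hL1'
    -- One dropping edge would not produce the factor `d`: low neighbours are charged to the energy,
    -- high ones to the mass.
    set A := (Γ.neighborFinset v₀).filter fun z => H z < τ with hA
    set B := (Γ.neighborFinset v₀).filter fun z => ¬ H z < τ with hB
    have hAB : A.card + B.card = d := by
      rw [← hcard v₀]
      exact Finset.card_filter_add_card_filter_not _
    have hA1 : 1 ≤ A.card := Finset.card_pos.mpr
      ⟨u, Finset.mem_filter.mpr ⟨(Γ.mem_neighborFinset _ _).mpr hau, hu⟩⟩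
    have hBM : τ * B.card ≤ M := hhigh B fun z hz => not_lt.mp (Finset.mem_filter.mp hz).2
    have hen := hE (A.image fun z => (v₀, z))
      (fun p hp => by
        obtain ⟨z, hz, rfl⟩ := Finset.mem_image.mp hp
        exact (Γ.mem_neighborFinset _ _).mp (Finset.mem_filter.mp hz).1)
      (fun p hp hq => by
        obtain ⟨z, hz, rfl⟩ := Finset.mem_image.mp hp
        obtain ⟨y, hy, h⟩ := Finset.mem_image.mp hq
        have h1 : v₀ = z := congrArg Prod.fst h
        rw [← h1] at hz
        have := (Finset.mem_filter.mp hz).2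
        linarith)
    rw [Finset.sum_image (fun a _ b _ h => congrArg Prod.snd h)] at hen
    have hAE : A.card * δ ^ 2 ≤ E := by
      refine le_trans ?_ hen
      rw [← nsmul_eq_mul]
      refine Finset.card_nsmul_le_sum _ _ _ fun z hz => ?_
      have := (Finset.mem_filter.mp hz).2
      exact pow_le_pow_left₀ hδ (by simp only; linarith) 2
    have hA1' : (1 : ℝ) ≤ A.card := by exact_mod_cast hA1
    have hdR' : (d : ℝ) = A.card + B.card := by exact_mod_cast hAB.symm
    have hM0 : 0 < M := hτ.trans_le hM1
    have h1 : d * τ ≤ 2 * M * A.card := by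
      rw [hdR']
      nlinarith
    calc d * δ ^ 2 * τ = (d * τ) * δ ^ 2 := by ring
      _ ≤ (2 * M * A.card) * δ ^ 2 := by gcongr
      _ = 2 * M * (A.card * δ ^ 2) := by ring
      _ ≤ 2 * M * E := by gcongr
      _ ≤ 4 * M * E := by nlinarith

/-- The bipartite double cover of a graph. -/
def doubleCover {V : Type*} (G : SimpleGraph V) : SimpleGraph (V × Bool) where
  Adj p q := G.Adj p.1 q.1 ∧ p.2 ≠ q.2
  symm := ⟨fun _ _ h => ⟨h.1.symm, h.2.symm⟩⟩
  loopless := ⟨fun _ h => h.2 rfl⟩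

/-! ### Regularity and connectedness of the double cover. -/

section DoubleCover

variable {V : Type*} {G : SimpleGraph V}

theorem doubleCover_adj {p q : V × Bool} :
    G.doubleCover.Adj p q ↔ G.Adj p.1 q.1 ∧ p.2 ≠ q.2 := Iff.rfl

theorem neighborSet_doubleCover (p : V × Bool) :
    G.doubleCover.neighborSet p = (fun v => (v, !p.2)) '' G.neighborSet p.1 := by
  ext ⟨v, b⟩
  simp only [mem_neighborSet, doubleCover_adj, Set.mem_image, Prod.mk.injEq]
  constructor
  · rintro ⟨h1, h2⟩
    exact ⟨v, h1, rfl, by revert h2; cases p.2 <;> cases b <;> simp⟩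
  · rintro ⟨_, h1, rfl, rfl⟩
    exact ⟨h1, by cases p.2 <;> simp⟩

noncomputable instance [G.LocallyFinite] : G.doubleCover.LocallyFinite := fun p =>
  Set.Finite.fintype (by rw [neighborSet_doubleCover]; exact (Set.toFinite _).image _)

theorem IsRegularOfDegree.doubleCover [G.LocallyFinite] {d : ℕ} (h : G.IsRegularOfDegree d) :
    G.doubleCover.IsRegularOfDegree d := by
  intro p
  rw [← card_neighborSet_eq_degree, ← Nat.card_eq_fintype_card, neighborSet_doubleCover,
    Nat.card_image_of_injective (fun a b hab => congrArg Prod.fst hab), Nat.card_eq_fintype_card,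
    card_neighborSet_eq_degree, h]

theorem Reachable.doubleCover_swap {p q : V × Bool} (h : G.doubleCover.Reachable p q) :
    G.doubleCover.Reachable (p.1, !p.2) (q.1, !q.2) :=
  h.map (⟨fun p => (p.1, !p.2), fun {_ _} hab => doubleCover_adj.mpr
    ⟨hab.1, by simpa using hab.2⟩⟩ : G.doubleCover →g G.doubleCover)

theorem Walk.exists_doubleCover_reachable {u v : V} (p : G.Walk u v) (b : Bool) :
    ∃ c, G.doubleCover.Reachable (u, b) (v, c) := by
  induction p generalizing b with
  | nil => exact ⟨b, .rfl⟩
  | cons h p ih =>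
    obtain ⟨c, hc⟩ := ih (!b)
    refine ⟨c, Reachable.trans (Adj.reachable ?_) hc⟩
    exact ⟨h, by simp⟩

theorem Connected.doubleCover (hG : G.Connected) (hb : ¬ G.IsBipartite) :
    G.doubleCover.Connected := by
  classical
  obtain ⟨x⟩ := hG.nonempty
  have hcov : ∀ u v b, ∃ c, G.doubleCover.Reachable (u, b) (v, c) := fun u v b =>
    (hG.preconnected u v).elim fun p => p.exists_doubleCover_reachable b
  have hx : G.doubleCover.Reachable (x, true) (x, false) := by
    -- If the two lifts of `x` are disconnected, each `v` has only one lift reachable from `(x,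
    -- true)`; its label is a proper 2-colouring.
    by_contra hx
    have huniq : ∀ v, ¬ (G.doubleCover.Reachable (x, true) (v, true) ∧
        G.doubleCover.Reachable (x, true) (v, false)) := fun v h =>
      hx (h.1.trans (by simpa using h.2.doubleCover_swap.symm))
    choose c hc using fun v => hcov x v true
    refine hb (Coloring.mk c fun {u v} huv hcuv => ?_ : G.Coloring Bool).colorable
    have h1 := (hc u).trans (Adj.reachable (v := (v, !c u)) ⟨huv, by simp⟩)
    have h2 := hc v
    rw [hcuv] at h1
    refine huniq v ?_
    cases hv : c v <;> rw [hv] at h1 h2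
    · exact ⟨h1, h2⟩
    · exact ⟨h2, h1⟩
  have hall : ∀ v b, G.doubleCover.Reachable (x, true) (v, b) := fun v b => by
    obtain ⟨c, hc⟩ := hcov v x b
    cases c
    · exact hx.trans hc.symm
    · exact hc.symm
  exact { preconnected := fun p q => (hall p.1 p.2).symm.trans (hall q.1 q.2)
          nonempty := ⟨(x, true)⟩ }

end DoubleCover

end SimpleGraph

/-! ### Two consecutive times of the walk as one function on the double cover. -/

namespace SimpleRandomWalk

section DoubleCover

variable {V : Type*} {G : SimpleGraph V} [G.LocallyFinite] {d : ℕ}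

theorem sum_doubleCover_le (x : V) (m : ℕ) (F : Finset (V × Bool)) :
    ∑ p ∈ F, transProb G (m + p.2.toNat) x p.1 ≤ 2 := by
  classical
  have hsub : F ⊆ F.image Prod.fst ×ˢ Finset.univ := fun p hp =>
    Finset.mem_product.mpr ⟨Finset.mem_image_of_mem _ hp, Finset.mem_univ _⟩
  refine (Finset.sum_le_sum_of_subset_of_nonneg hsub
    fun p _ _ => transProb_nonneg _ _ _).trans ?_
  rw [Finset.sum_product_right, Fintype.sum_bool]
  have h0 := sum_le_hasSum (F.image Prod.fst) (fun y _ => transProb_nonneg _ _ _)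
    (hasSum_transProb (G := G) m x)
  have h1 := sum_le_hasSum (F.image Prod.fst) (fun y _ => transProb_nonneg _ _ _)
    (hasSum_transProb (G := G) (m + 1) x)
  simp only [Bool.toNat_true, Bool.toNat_false, add_zero]
  linarith

theorem energy_doubleCover_le (hreg : G.IsRegularOfDegree d) (hd : 0 < d) (x : V) (m : ℕ)
    (F : Finset ((V × Bool) × (V × Bool))) (hadj : ∀ p ∈ F, G.doubleCover.Adj p.1 p.2)
    (hswap : ∀ p ∈ F, p.swap ∉ F) :
    ∑ p ∈ F, (transProb G (m + p.1.2.toNat) x p.1.1 -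
        transProb G (m + p.2.2.toNat) x p.2.1) ^ 2 ≤
      d * (transProb G (2 * m) x x - transProb G (2 * (m + 1)) x x) := by
  classical
  -- Orients each edge from the `true` sheet (time `m + 1`) to the `false` sheet (time `m`);
  -- injective on `F` since no edge occurs in both directions.
  let φ : (V × Bool) × (V × Bool) → (_ : V) × V := fun p =>
    if p.1.2 then ⟨p.1.1, p.2.1⟩ else ⟨p.2.1, p.1.1⟩
  let g : (_ : V) × V → ℝ := fun q => (transProb G m x q.2 - transProb G (m + 1) x q.1) ^ 2
  have hinj : Set.InjOn φ F := by
    rintro ⟨⟨u, a⟩, ⟨v, b⟩⟩ hp ⟨⟨u', a'⟩, ⟨v', b'⟩⟩ hq h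
    have h1 := (hadj _ hp).2
    have h2 := (hadj _ hq).2
    have h3 := hswap _ hp
    cases a <;> cases b <;> cases a' <;> cases b' <;> simp_all [φ]
  have hg : ∀ p ∈ F, (transProb G (m + p.1.2.toNat) x p.1.1 -
      transProb G (m + p.2.2.toNat) x p.2.1) ^ 2 = g (φ p) := by
    rintro ⟨⟨u, a⟩, ⟨v, b⟩⟩ hp
    have h1 := (hadj _ hp).2
    cases a <;> cases b
    · exact absurd rfl h1
    · rfl
    · exact sub_sq_comm _ _
    · exact absurd rfl h1
  have hsub : F.image φ ⊆ ((F.image φ).image Sigma.fst).sigma fun v => G.neighborFinset v := by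
    intro q hq
    refine Finset.mem_sigma.mpr ⟨Finset.mem_image_of_mem _ hq, ?_⟩
    obtain ⟨⟨⟨u, a⟩, ⟨v, b⟩⟩, hp, rfl⟩ := Finset.mem_image.mp hq
    have h1 := (hadj _ hp).1
    cases a
    · exact (G.mem_neighborFinset _ _).mpr h1.symm
    · exact (G.mem_neighborFinset _ _).mpr h1
  have hnn : ∀ y, 0 ≤ (∑ z ∈ G.neighborFinset y,
      (transProb G m x z - transProb G (m + 1) x y) ^ 2) / d := fun y =>
    div_nonneg (Finset.sum_nonneg fun _ _ => sq_nonneg _) (Nat.cast_nonneg d)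
  have hle := sum_le_hasSum ((F.image φ).image Sigma.fst) (fun y _ => hnn y)
    (hasSum_energy hreg hd x m)
  rw [← Finset.sum_div, div_le_iff₀' (by exact_mod_cast hd)] at hle
  rw [Finset.sum_congr rfl hg, ← Finset.sum_image hinj]
  refine le_trans (Finset.sum_le_sum_of_subset_of_nonneg hsub fun _ _ _ => sq_nonneg _) ?_
  rw [Finset.sum_sigma]
  exact hle

theorem transProb_even_succ_le (hreg : G.IsRegularOfDegree d) (hd : 0 < d) (x : V) (m : ℕ) :
    transProb G (2 * (m + 1)) x x ≤ transProb G (2 * m) x x :=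
  sub_nonneg.mp <| (hasSum_energy hreg hd x m).nonneg fun _ =>
    div_nonneg (Finset.sum_nonneg fun _ _ => sq_nonneg _) (Nat.cast_nonneg d)

theorem antitone_transProb_even (hreg : G.IsRegularOfDegree d) (hd : 0 < d) (x : V) :
    Antitone fun m => transProb G (2 * m) x x :=
  antitone_nat_of_succ_le (transProb_even_succ_le hreg hd x)

/-- A Nash type inequality for the even return probabilities. -/
theorem transProb_even_cube_le (hreg : G.IsRegularOfDegree d) (hd : 0 < d) (hconn : G.Connected)
    (hbip : ¬ G.IsBipartite) (x : V) (m : ℕ) :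
    (transProb G (2 * m) x x - statProb G x) ^ 3 ≤
      54 * (transProb G (2 * m) x x - transProb G (2 * (m + 1)) x x) := by
  set β := transProb G (2 * m) x x - statProb G x with hβ
  have hβ0 : 0 ≤ β := statProb_le_transProb_even hreg hd x m
  rcases hβ0.eq_or_lt with h0 | hpos
  · rw [← h0]
    have := transProb_even_succ_le hreg hd x m
    norm_num
    linarith
  have hπ := statProb_nonneg (G := G) x
  -- Start on the sheet whose time is even, where monotonicity of return probabilities applies.
  obtain ⟨b, hb⟩ : ∃ b : Bool, 2 * ((m + 1) / 2) = m + b.toNat := by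
    rcases Nat.even_or_odd' m with ⟨k, rfl | rfl⟩
    · exact ⟨false, by simp; omega⟩
    · exact ⟨true, by simp; omega⟩
  have hstart : transProb G (2 * m) x x ≤ transProb G (m + b.toNat) x x := by
    rw [← hb]
    exact antitone_transProb_even hreg hd x (by omega)
  obtain ⟨y, hy⟩ := exists_transProb_lt hreg hd x m (θ := β / 3) (by positivity)
  -- Here `τ + δ = π + β` and `δ² τ ≥ 4β³/27`; with `4M = 8` this gives the constant 54.
  have key := (hconn.doubleCover hbip).energy_lower_bound hreg.doubleCover hd
    (H := fun p => transProb G (m + p.2.toNat) x p.1) (M := 2)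
    (E := d * (transProb G (2 * m) x x - transProb G (2 * (m + 1)) x x))
    (τ := statProb G x + β / 3) (δ := 2 * β / 3) (v₀ := (x, b))
    (sum_doubleCover_le x m)
    (energy_doubleCover_le hreg hd x m) (by positivity) (by positivity)
    (by simp only; linarith) ⟨(y, false), by simpa using hy⟩
  have hdR : (0 : ℝ) < d := by exact_mod_cast hd
  have key' : (2 * β / 3) ^ 2 * (statProb G x + β / 3) ≤
      8 * (transProb G (2 * m) x x - transProb G (2 * (m + 1)) x x) := by
    refine le_of_mul_le_mul_left ?_ hdR
    linarith
  have : 0 ≤ (2 * β / 3) ^ 2 * statProb G x := by positivity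
  nlinarith

end DoubleCover

/-! ### From the cubic recursion to decay, and the final constants. -/

theorem nat_mul_sq_le_of_cube_le {b : ℕ → ℝ} (hb : ∀ m, 0 ≤ b m)
    (h : ∀ m, b m ^ 3 ≤ 54 * (b m - b (m + 1))) (m : ℕ) : m * b m ^ 2 ≤ 27 := by
  induction m with
  | zero => norm_num
  | succ m ih =>
    rcases (hb m).eq_or_lt with h0 | hpos
    · have := h m
      rw [← h0] at this
      have h1 : b (m + 1) = 0 := le_antisymm (by linarith) (hb _)
      norm_num [h1]
    obtain ⟨u, hu⟩ : ∃ u, u = b m ^ 2 / 54 := ⟨_, rfl⟩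
    have h1 : b (m + 1) ≤ b m * (1 - u) := by
      rw [hu]
      linarith [h m]
    have hu1 : 0 ≤ 1 - u := by
      by_contra! hneg
      nlinarith [hb (m + 1)]
    have hu0 : 0 ≤ u := by rw [hu]; positivity
    have hsq : b m ^ 2 = 54 * u := by rw [hu]; ring
    have h2 : b (m + 1) ^ 2 ≤ 54 * u * (1 - u) ^ 2 := by
      rw [← hsq, ← mul_pow]
      exact pow_le_pow_left₀ (hb _) h1 2
    rw [hsq] at ih
    push_cast
    calc ((m : ℝ) + 1) * b (m + 1) ^ 2 ≤ (m + 1) * (54 * u * (1 - u) ^ 2) := by gcongr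
      _ = (m * (54 * u) + 54 * u) * (1 - u) ^ 2 := by ring
      _ ≤ (27 + 54 * u) * (1 - u) ^ 2 := by gcongr
      -- The difference is `27u²(3 - 2u) = 27u²(1 + 2(1 - u))`.
      _ ≤ 27 := by nlinarith [mul_nonneg (sq_nonneg u) hu1]

theorem nat_mul_transProb_even_sq_le {V : Type*} {G : SimpleGraph V} [G.LocallyFinite] {d : ℕ}
    (hreg : G.IsRegularOfDegree d) (hd : 0 < d) (hconn : G.Connected) (hbip : ¬ G.IsBipartite)
    (x : V) (m : ℕ) : m * (transProb G (2 * m) x x - statProb G x) ^ 2 ≤ 27 := by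
  refine nat_mul_sq_le_of_cube_le (b := fun m => transProb G (2 * m) x x - statProb G x)
    (statProb_le_transProb_even hreg hd x) (fun m => ?_) m
  simpa using transProb_even_cube_le hreg hd hconn hbip x m

theorem le_div_sqrt_of_mul_sq_le {a c t : ℝ} (hc : 0 ≤ c) (ht : 0 < t) (h : t * a ^ 2 ≤ c ^ 2) :
    a ≤ c / √t := by
  rw [le_div_iff₀ (Real.sqrt_pos.mpr ht)]
  refine le_of_abs_le (abs_le_of_sq_le_sq ?_ hc)
  rw [mul_pow, Real.sq_sqrt ht.le]
  linarith

end SimpleRandomWalk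

theorem mainTheorem2 {V : Type*} (G : SimpleGraph V) [G.LocallyFinite] (d : ℕ)
    (hreg : G.IsRegularOfDegree d) (hconn : G.Connected) (hbip : ¬ G.IsBipartite) (x : V) :
    (∀ t : ℕ, Even t →
      0 ≤ SimpleRandomWalk.transProb G t x x - SimpleRandomWalk.statProb G x) ∧
    (∀ t : ℕ, 0 < t → Even t →
      SimpleRandomWalk.transProb G t x x - SimpleRandomWalk.statProb G x ≤ 18 / √(t : ℝ)) ∧
    (∀ t : ℕ, Odd t →
      |SimpleRandomWalk.transProb G t x x - SimpleRandomWalk.statProb G x| ≤ 9 / √(t : ℝ)) := by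
  open SimpleRandomWalk in
  have hd : 0 < d := by
    refine Nat.pos_of_ne_zero fun h0 => hbip ⟨SimpleGraph.Coloring.mk (fun _ => 0) ?_⟩
    intro u v huv
    have := (G.degree_pos_iff_exists_adj u).mpr ⟨v, huv⟩
    rw [hreg.degree_eq, h0] at this
    exact absurd this (lt_irrefl 0)
  have hbound := nat_mul_transProb_even_sq_le hreg hd hconn hbip x
  refine ⟨fun t ht => ?_, fun t h0 ht => ?_, fun t ht => ?_⟩
  · obtain ⟨m, rfl⟩ := ht.exists_two_nsmul
    exact statProb_le_transProb_even hreg hd x m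
  · obtain ⟨m, rfl⟩ := ht.exists_two_nsmul
    refine le_div_sqrt_of_mul_sq_le (by norm_num) (by exact_mod_cast h0) ?_
    have := hbound m
    rw [smul_eq_mul]
    push_cast
    linarith
  · obtain ⟨m, rfl⟩ := ht
    refine le_div_sqrt_of_mul_sq_le (by norm_num) (by positivity) ?_
    rcases Nat.eq_zero_or_pos m with rfl | hm
    · have h1 : |transProb G (2 * 0 + 1) x x - statProb G x| ≤ 1 := abs_sub_le_of_nonneg_of_le
        (transProb_nonneg _ _ _) (transProb_le_one _ _ _) (statProb_nonneg x)
        (statProb_le_one hreg hd x)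
      have h2 := abs_nonneg (transProb G (2 * 0 + 1) x x - statProb G x)
      push_cast
      nlinarith
    · have h1 := abs_transProb_odd_le hreg hd x m
      have h2 := transProb_even_succ_le hreg hd x m
      have h3 : |transProb G (2 * m + 1) x x - statProb G x| ^ 2 ≤
          (transProb G (2 * m) x x - statProb G x) ^ 2 :=
        pow_le_pow_left₀ (abs_nonneg _) (by linarith) 2
      -- Now `2m + 1 ≤ 3m`, and `3 · 27 = 9²`.
      have hm' : (1 : ℝ) ≤ m := by exact_mod_cast hm
      have := hbound m
      push_cast
      nlinarith [sq_nonneg |transProb G (2 * m + 1) x x - statProb G x|]
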